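/- Let $d \ge 0$ be an integer and let $\Delta_d = \{x \in \mathbb{R}^{d+1} : x_0, \dots, x_d \ge 0,\ x_0 + \dots + x_d = 1\}$ be the standard $d$-simplex. For $I \subseteq \{0, \dots, d\}$, the face of $\Delta_d$ determined by $I$ is $\{x \in \Delta_d : x_i = 0 \text{ for all } i \notin I\}$. A dual KKM cover of $\Delta_d$ is a collection of closed subsets $C_0, \dots, C_d \subseteq \Delta_d$ such that $\bigcup_{i=0}^d C_i = \Delta_d$ and, for every proper subset $I \subsetneq \{0, \dots, d\}$, the face of $\Delta_d$ determined by $I$ is covered by $\bigcup_{i \in \{0,\dots,d\} \setminus I} C_i$. Theorem (Strong dual colorful KKM theorem). Given $d$ dual KKM covers $\{C^1_i\}_{i=0,\dots,d}, \dots, \{C^d_i\}_{i=0,\dots,d}$ of $\Delta_d$, there are a point $x \in \Delta_d$ and $d+1$ bijections $\pi_i \colon \{1,\dots,d\} \to \{0,\dots,d\} \setminus \{i\}$, $i \in \{0,\dots,d\}$, such that for every $i$ we have $x \in C^1_{\pi_i(1)} \cap \dots \cap C^d_{\pi_i(d)}$. -/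

import Mathlib

/-- The face of the standard `d`-simplex
`Δ_d = {x ∈ ℝ^{d+1} : x_i ≥ 0, ∑ x_i = 1}` determined by a set `I` of its vertices: the points
of the simplex whose barycentric coordinates outside `I` vanish (empty for `I = ∅`). -/
def simplexFace {d : ℕ} (I : Set (Fin (d + 1))) : Set (Fin (d + 1) → ℝ) :=
  {x | x ∈ stdSimplex ℝ (Fin (d + 1)) ∧ ∀ i, i ∉ I → x i = 0}

/-- A dual KKM cover of the standard `d`-simplex: closed subsets `C_0, …, C_d` whose union is the
simplex, such that for each proper subset `I` of the vertices, the face determined by `I` is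
covered by the sets `C_i` with `i ∉ I`. -/
structure IsDualKKMCover {d : ℕ} (C : Fin (d + 1) → Set (Fin (d + 1) → ℝ)) : Prop where
  isClosed : ∀ i, IsClosed (C i)
  subset_simplex : ∀ i, C i ⊆ stdSimplex ℝ (Fin (d + 1))
  face_subset : ∀ I : Set (Fin (d + 1)), I ≠ Set.univ → simplexFace I ⊆ ⋃ i ∈ Iᶜ, C i
  iUnion_eq : ⋃ i, C i = stdSimplex ℝ (Fin (d + 1))

/-!
The defining property of a dual KKM cover says exactly that `C i` contains the facet `x i = 0`.
Suppose one has, at some point `x`, weights `w j k ≥ 0` with `x ∈ C j k` whenever `w j k > 0`,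
with row sums `1` and column sums `d / (d + 1)`. Deleting any column leaves Hall's condition
intact (`exists_equiv_of_balanced`): `a` rows have total weight `a`, while column `i` and `b`
further columns carry at most `(1 + b) * d / (d + 1)`, which is less than `a` if `b < a`. This
gives all the bijections at once.

Such weights exist up to an error `ε`, which compactness removes at the end. They are normalised
continuous functions `coverWeight`, which are supported near `C j k`, and on the boundary of the
simplex in `x k < ε`. A point with balanced columns (`exists_balanced_coverWeight`) comes from the
dual KKM theorem `exists_mem_of_ne_zero`, applied to the closed sets where the `k`-th column sum
is at least its average: the theorem gives a point lying in the `k`-th of these sets for every `k`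
with `x k ≠ 0`, and such a point cannot be on the boundary because there the column of the largest
coordinate carries no weight.

The dual KKM theorem is the limit of a statement about coloured lattice points
(`exists_near_all_colours`). In place of a triangulation, the proof uses Scarf's combinatorial
notion of a dominant set, ranking the lattice points, and one extra corner per direction, by each
of the coordinates; the parity argument of Sperner's lemma then applies
(`exists_dominant_image_eq_univ`), since a dominant set with one element fewer than there are
rankings has exactly two dominant one-point extensions, or just one if it consists of corners.
-/

/-! ### Dominant sets -/

/-- For a family `r` of rankings of `α`, a finite set `S` is dominant if no element of `α` beats
the `r i`-minimum of `S` for every `i` simultaneously. -/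
def Dominant {ι α β : Type*} [LinearOrder β] (r : ι → α → β) (S : Finset α) : Prop :=
  ∀ y, ∃ i, ∀ x ∈ S, r i y ≤ r i x

section Dominant

variable {ι α β : Type*} [LinearOrder β] {r : ι → α → β}

/-- A dominant set with one element fewer than there are rankings has two rankings `a ≠ b` sharing
their minimum `m a = m b`. Its dominant one-point extensions are obtained by giving up the
constraint of `a` or of `b`: the new point is the `r i`-largest of those exceeding the `r k`-minimum of the set for
all `k ≠ i`, where `i` is `a` or `b`. -/
theorem Dominant.exists_insert_iff [Fintype ι] [DecidableEq α] (hr : ∀ i, Function.Injective (r i))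
    {τ : Finset α} (hτ : Dominant r τ) (hcard : τ.card + 1 = Fintype.card ι) (hne : τ.Nonempty) :
    ∃ m : ι → α, (∀ i, m i ∈ τ ∧ ∀ t ∈ τ, r i (m i) ≤ r i t) ∧ ∃ a b, a ≠ b ∧
      ∀ x, (x ∉ τ ∧ Dominant r (insert x τ)) ↔
        ∃ i, (i = a ∨ i = b) ∧ (∀ k, k ≠ i → r k (m k) < r k x) ∧
          ∀ y, (∀ k, k ≠ i → r k (m k) < r k y) → r i y ≤ r i x := by
  classical
  choose m hmτ hmin using fun i => τ.exists_min_image (r i) hne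
  have hsurj : ∀ t ∈ τ, ∃ k, m k = t := fun t ht => by
    obtain ⟨k, hk⟩ := hτ t
    exact ⟨k, hr k (le_antisymm (hmin k t ht) (hk _ (hmτ k)))⟩
  obtain ⟨a, -, b, -, hab, hmab⟩ := Finset.exists_ne_map_eq_of_card_lt_of_maps_to
    (s := Finset.univ) (t := τ) (by rw [Finset.card_univ]; omega) (fun i _ => hmτ i)
  refine ⟨m, fun i => ⟨hmτ i, hmin i⟩, a, b, hab, fun x => ⟨?_, ?_⟩⟩
  · rintro ⟨hx, hdom⟩
    -- Every element of the extended set is its minimum for some ranking, hence for exactly one.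
    choose g hg using fun t : ↥(insert x τ) => hdom t
    have hginj : Function.Injective g := fun t u htu => Subtype.ext <| hr (g t) <|
      le_antisymm (hg t u u.2) (by rw [htu]; exact hg u t t.2)
    have hgbij : Function.Bijective g := (Fintype.bijective_iff_injective_and_card g).2
      ⟨hginj, by rw [Fintype.card_coe, Finset.card_insert_of_notMem hx, hcard]⟩
    set x' : ↥(insert x τ) := ⟨x, Finset.mem_insert_self _ _⟩
    have key : ∀ k, k ≠ g x' → ∃ t : ↥(insert x τ), g t = k ∧ (t : α) = m k ∧
        r k (m k) < r k x := fun k hk => by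
      obtain ⟨t, rfl⟩ := hgbij.2 k
      have htx : (t : α) ≠ x := fun h => hk (congrArg g (Subtype.ext h))
      have htτ : (t : α) ∈ τ := (Finset.mem_insert.1 t.2).resolve_left htx
      have htm : (t : α) = m (g t) := hr _ <|
        le_antisymm (hg t _ (Finset.mem_insert_of_mem (hmτ _))) (hmin _ _ htτ)
      refine ⟨t, rfl, htm, lt_of_le_of_ne ?_ fun h => htx (htm.trans (hr _ h))⟩
      rw [← htm]
      exact hg t x (Finset.mem_insert_self _ _)
    refine ⟨g x', ?_, fun k hk => (key k hk).choose_spec.2.2, fun y hy => ?_⟩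
    · by_contra! h
      obtain ⟨t, hta, htm, -⟩ := key a h.1.symm
      obtain ⟨u, hub, hum, -⟩ := key b h.2.symm
      exact hab (by rw [← hta, ← hub, Subtype.ext (htm.trans (hmab.trans hum.symm))])
    · obtain ⟨k, hk⟩ := hdom y
      by_cases hki : k = g x'
      · exact hki ▸ hk x (Finset.mem_insert_self _ _)
      · exact absurd (hk _ (Finset.mem_insert_of_mem (hmτ k))) (not_le.2 (hy k hki))
  · rintro ⟨i, hi, hx, hmax⟩
    refine ⟨fun hxτ => ?_, fun y => ?_⟩
    · -- As `m a = m b`, the point `x` would be the minimum for a ranking other than `i`.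
      obtain ⟨k, hki, hk⟩ : ∃ k, k ≠ i ∧ m k = x := by
        obtain ⟨k, hk⟩ := hsurj x hxτ
        by_cases hki : k = i
        · rcases hi with rfl | rfl
          · exact ⟨b, hab.symm, by rw [← hmab, ← hki, hk]⟩
          · exact ⟨a, hab, by rw [hmab, ← hki, hk]⟩
        · exact ⟨k, hki, hk⟩
      exact absurd (hx k hki) (by rw [hk]; exact lt_irrefl _)
    · by_cases hy : ∀ k, k ≠ i → r k (m k) < r k y
      · obtain ⟨k, hk⟩ := hτ y
        have hki : k = i := by
          by_contra hki
          exact absurd (hk _ (hmτ k)) (not_le.2 (hy k hki))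
        subst hki
        exact ⟨k, Finset.forall_mem_insert _ _ _ |>.2 ⟨hmax y hy, hk⟩⟩
      · push Not at hy
        obtain ⟨k, hki, hk⟩ := hy
        exact ⟨k, Finset.forall_mem_insert _ _ _ |>.2
          ⟨hk.trans (hx k hki).le, fun t ht => hk.trans (hmin k t ht)⟩⟩

end Dominant

/-! ### The parity argument -/

/-- A set that misses a colour has an even number of subsets (in fact none or two) with one
element fewer that carry every colour but `o` exactly once. -/
theorem even_card_doors {ι α : Type*} [Fintype ι] [DecidableEq ι] [DecidableEq α]
    (c : α → ι) (o : ι) {S : Finset α} (hS : S.card = Fintype.card ι)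
    (hc : S.image c ≠ Finset.univ) {D : Finset (Finset α)}
    (hD : ∀ τ ⊆ S, τ ∈ D ↔ τ.card + 1 = Fintype.card ι ∧ τ.image c = Finset.univ.erase o) :
    Even (D.filter (· ⊆ S)).card := by
  rcases (D.filter (· ⊆ S)).eq_empty_or_nonempty with h | ⟨τ, hτ⟩
  · simp [h]
  obtain ⟨hτD, hτS⟩ := Finset.mem_filter.1 hτ
  obtain ⟨hcard, himg⟩ := (hD τ hτS).1 hτD
  obtain ⟨x, hx, rfl⟩ := Finset.exists_eq_insert_iff.2 ⟨hτS, hcard.trans hS.symm⟩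
  have hinj : Set.InjOn c τ := Finset.card_image_iff.1 (by
    rw [himg, Finset.card_erase_of_mem (Finset.mem_univ _), Finset.card_univ]; omega)
  have hxo : c x ≠ o := fun h => hc (by
    rw [Finset.image_insert, himg, h, Finset.insert_erase (Finset.mem_univ _)])
  obtain ⟨t, ht, htx⟩ : ∃ t ∈ τ, c t = c x := Finset.mem_image.1
    (himg ▸ Finset.mem_erase.2 ⟨hxo, Finset.mem_univ _⟩)
  have hne : t ≠ x := fun h => hx (h ▸ ht)
  have htwo : D.filter (· ⊆ insert x τ) = {τ, (insert x τ).erase t} := by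
    ext ρ
    simp only [Finset.mem_filter, Finset.mem_insert, Finset.mem_singleton]
    constructor
    · rintro ⟨hρD, hρS⟩
      obtain ⟨hρc, hρi⟩ := (hD ρ hρS).1 hρD
      obtain ⟨z, hz, hzρ⟩ := Finset.exists_eq_insert_iff.2 ⟨hρS, hρc.trans hS.symm⟩
      have hρ : ρ = (insert x τ).erase z := by rw [← hzρ, Finset.erase_insert hz]
      have hzS : z ∈ insert x τ := hzρ ▸ Finset.mem_insert_self _ _
      rcases Finset.mem_insert.1 hzS with rfl | hzτ
      · left
        rw [hρ, Finset.erase_insert hx]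
      · right
        have hmem : c z ∈ ρ.image c := by
          rw [hρi, ← himg]
          exact Finset.mem_image_of_mem c hzτ
        obtain ⟨w, hw, hwz⟩ := Finset.mem_image.1 hmem
        have hwz' : w ≠ z := fun h => hz (h ▸ hw)
        rcases Finset.mem_insert.1 (hρS hw) with rfl | hwτ
        · rw [hρ, hinj ht hzτ (htx.trans hwz)]
        · exact absurd (hinj hwτ hzτ hwz) hwz'
    · rintro (rfl | rfl)
      · exact ⟨hτD, hτS⟩
      · have hsub := Finset.erase_subset t (insert x τ)
        refine ⟨(hD _ hsub).2 ⟨?_, ?_⟩, hsub⟩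
        · rw [Finset.card_erase_add_one (hτS ht), hS]
        · rw [← himg, Finset.erase_insert_of_ne hne.symm, Finset.image_insert, ← htx,
            ← Finset.image_insert, Finset.insert_erase ht]
  rw [htwo, Finset.card_pair]
  · exact even_two
  · intro h
    have : t ∈ (insert x τ).erase t := h ▸ ht
    simp at this

section Parity

variable {ι α β : Type*} [Fintype ι] [DecidableEq ι] [Fintype α] [DecidableEq α] [LinearOrder β]
  {r : ι → α → β} {e : ι → α}

/-- If a dominant set `τ` with one element fewer than there are rankings
contains a point that is not one of the corners `e j`, it has exactly two dominant one-point
extensions. -/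
theorem exists_two_dominant_extensions (hr : ∀ i, Function.Injective (r i))
    (hmin : ∀ i y, r i (e i) ≤ r i y)
    (hbig : ∀ i j x, i ≠ j → x ∉ Set.range e → r i x < r i (e j))
    {τ : Finset α} (hτ : Dominant r τ) (hcard : τ.card + 1 = Fintype.card ι)
    (hin : ∃ t ∈ τ, t ∉ Set.range e) :
    ∃ x y, x ≠ y ∧ ∀ z, (z ∉ τ ∧ Dominant r (insert z τ)) ↔ (z = x ∨ z = y) := by
  classical
  obtain ⟨t, ht, hte⟩ := hin
  obtain ⟨m, hm, a, b, hab, hiff⟩ := hτ.exists_insert_iff hr hcard ⟨t, ht⟩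
  let M : ι → Finset α := fun i => {y | ∀ k, k ≠ i → r k (m k) < r k y}
  have hM : ∀ i, (M i).Nonempty := fun i => by
    refine ⟨e i, Finset.mem_filter.2 ⟨Finset.mem_univ _, fun k hki => ?_⟩⟩
    by_cases hmk : m k ∈ Set.range e
    · obtain ⟨j, hj⟩ := hmk
      have hjk : k = j := by
        by_contra hkj
        exact absurd ((hm k).2 t ht) (not_le.2 (hj ▸ hbig k j t hkj hte))
      subst hjk
      rw [← hj]
      refine lt_of_le_of_ne (hmin k _) fun h => ?_
      have heq := hr k h
      -- `e k = e i` with `k ≠ i` would make `e i` both minimal for `k` and larger than `t`.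
      have h1 := hbig k i t hki hte
      rw [← heq] at h1
      exact absurd (hmin k t) (not_le.2 h1)
    · exact hbig k i _ hki hmk
  choose x hxM hxmax using fun i => (M i).exists_max_image (r i) (hM i)
  have hxM' : ∀ i k, k ≠ i → r k (m k) < r k (x i) := fun i => (Finset.mem_filter.1 (hxM i)).2
  have huniq : ∀ i z, ((∀ k, k ≠ i → r k (m k) < r k z) ∧
      ∀ y, (∀ k, k ≠ i → r k (m k) < r k y) → r i y ≤ r i z) ↔ z = x i := fun i z => by
    constructor
    · rintro ⟨h1, h2⟩
      exact hr i (le_antisymm (hxmax i z (Finset.mem_filter.2 ⟨Finset.mem_univ _, h1⟩))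
        (h2 _ (hxM' i)))
    · rintro rfl
      exact ⟨hxM' i, fun y hy => hxmax i y (Finset.mem_filter.2 ⟨Finset.mem_univ _, hy⟩)⟩
  refine ⟨x a, x b, fun h => ?_, fun z => ?_⟩
  · -- A common value would beat every minimum of `τ`.
    obtain ⟨k, hk⟩ := hτ (x a)
    refine absurd (hk _ (hm k).1) (not_le.2 ?_)
    by_cases hka : k = a
    · rw [h]
      exact hxM' b k (hka ▸ hab)
    · exact hxM' a k hka
  · rw [hiff]
    simp only [huniq, or_and_right, exists_or, exists_eq_left]

/-- The set of all corners but one is dominant, and has exactly one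
dominant one-point extension. -/
theorem exists_unique_dominant_extension_corners (hr : ∀ i, Function.Injective (r i))
    (hmin : ∀ i y, r i (e i) ≤ r i y)
    (hbig : ∀ i j x, i ≠ j → x ∉ Set.range e → r i x < r i (e j)) (he : Function.Injective e)
    (o : ι) : ∃ x, ∀ z, (z ∉ (Finset.univ.erase o).image e ∧
      Dominant r (insert z ((Finset.univ.erase o).image e))) ↔ z = x := by
  set τ := (Finset.univ.erase o).image e with hτ
  have hmem : ∀ j, j ≠ o → e j ∈ τ := fun j hj =>
    Finset.mem_image_of_mem e (Finset.mem_erase.2 ⟨hj, Finset.mem_univ _⟩)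
  have hmem' : ∀ y ∈ τ, ∃ j, j ≠ o ∧ e j = y := fun y hy => by
    obtain ⟨j, hj, rfl⟩ := Finset.mem_image.1 hy
    exact ⟨j, (Finset.mem_erase.1 hj).1, rfl⟩
  have ho : e o ∈ τᶜ := Finset.mem_compl.2 fun h => by
    obtain ⟨j, hj, hje⟩ := hmem' _ h
    exact hj (he hje)
  have hiff : ∀ z, z ∉ τ → (Dominant r (insert z τ) ↔ ∀ y ∉ τ, r o y ≤ r o z) := by
    intro z hz
    constructor
    · intro hdom y hy
      obtain ⟨k, hk⟩ := hdom y
      by_cases hko : k = o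
      · exact hko ▸ hk z (Finset.mem_insert_self _ _)
      · refine absurd ?_ hy
        rw [hr k (le_antisymm (hk _ (Finset.mem_insert_of_mem (hmem k hko))) (hmin k y))]
        exact hmem k hko
    · intro hz y
      by_cases hy : y ∈ τ
      · obtain ⟨j, -, rfl⟩ := hmem' y hy
        exact ⟨j, fun x _ => hmin j x⟩
      · refine ⟨o, Finset.forall_mem_insert _ _ _ |>.2 ⟨hz y hy, fun t ht => ?_⟩⟩
        obtain ⟨j, hj, rfl⟩ := hmem' t ht
        by_cases hye : y ∈ Set.range e
        · obtain ⟨k, rfl⟩ := hye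
          have hko : k = o := by
            by_contra hko
            exact hy (hmem k hko)
          exact hko ▸ hmin k _
        · exact (hbig o j y hj.symm hye).le
  obtain ⟨x, hx, hmax⟩ := τᶜ.exists_max_image (r o) ⟨_, ho⟩
  refine ⟨x, fun z => ⟨fun ⟨hz, hdom⟩ => ?_, ?_⟩⟩
  · exact hr o (le_antisymm (hmax z (Finset.mem_compl.2 hz))
      ((hiff z hz).1 hdom x (Finset.mem_compl.1 hx)))
  · rintro rfl
    exact ⟨Finset.mem_compl.1 hx, (hiff _ (Finset.mem_compl.1 hx)).2
      fun y hy => hmax y (Finset.mem_compl.2 hy)⟩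

/-- **Scarf's lemma**: if the corners `e i` are the `r i`-smallest points, and `r j`-larger than
all non-corners for `j ≠ i`, then every colouring that gives the corner `e i` colour `i` has a
dominant set carrying all colours. As in Sperner's lemma, the proof counts incidences between rooms
(dominant sets with as many elements as there are rankings) and doors (dominant sets with one
element fewer that carry all colours but a fixed one `o`). -/
theorem exists_dominant_image_eq_univ [Nonempty ι] (hr : ∀ i, Function.Injective (r i))
    (hmin : ∀ i y, r i (e i) ≤ r i y)
    (hbig : ∀ i j x, i ≠ j → x ∉ Set.range e → r i x < r i (e j))
    (c : α → ι) (hce : ∀ i, c (e i) = i) :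
    ∃ S : Finset α, Dominant r S ∧ S.image c = Finset.univ := by
  classical
  by_contra! hno
  have he : Function.Injective e := fun i j h => by rw [← hce i, h, hce j]
  obtain ⟨o⟩ := ‹Nonempty ι›
  let R : Finset (Finset α) := {S | S.card = Fintype.card ι ∧ Dominant r S}
  let D : Finset (Finset α) := {τ | (τ.card + 1 = Fintype.card ι ∧
    τ.image c = Finset.univ.erase o) ∧ Dominant r τ}
  have hR : ∀ S, S ∈ R ↔ S.card = Fintype.card ι ∧ Dominant r S := fun S => by simp [R]
  have hD : ∀ τ, τ ∈ D ↔ (τ.card + 1 = Fintype.card ι ∧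
    τ.image c = Finset.univ.erase o) ∧ Dominant r τ := fun τ => by simp [D]
  have hdom_sub : ∀ {S τ : Finset α}, τ ⊆ S → Dominant r S → Dominant r τ :=
    fun hsub hS y => (hS y).imp fun i hi x hx => hi x (hsub hx)
  have hcount := Finset.sum_card_bipartiteAbove_eq_sum_card_bipartiteBelow
    (s := D) (t := R) (fun τ S => τ ⊆ S)
  -- `R` are the rooms and `D` the doors; incidences are counted in two ways. Each room has an even
  -- number of doors, since no room carries all colours.
  have hright : Even (∑ S ∈ R, (D.bipartiteBelow (fun τ S => τ ⊆ S) S).card) := by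
    refine Finset.even_sum _ fun S hS => ?_
    obtain ⟨hSc, hSd⟩ := (hR S).1 hS
    exact even_card_doors c o hSc (hno S hSd) fun τ hτ => by
      rw [hD, and_iff_left (hdom_sub hτ hSd)]
  -- The rooms over a door correspond to its dominant one-point extensions.
  have hrooms : ∀ τ, τ.card + 1 = Fintype.card ι →
      R.bipartiteAbove (fun τ S => τ ⊆ S) τ =
        (Finset.univ.filter fun z => z ∉ τ ∧ Dominant r (insert z τ)).image
          (fun z => insert z τ) := fun τ hτ => by
    ext S
    simp only [Finset.mem_bipartiteAbove, hR, Finset.mem_image, Finset.mem_filter,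
      Finset.mem_univ, true_and]
    constructor
    · rintro ⟨⟨hSc, hSd⟩, hsub⟩
      obtain ⟨z, hz, rfl⟩ := Finset.exists_eq_insert_iff.2 ⟨hsub, hτ.trans hSc.symm⟩
      exact ⟨z, ⟨hz, hSd⟩, rfl⟩
    · rintro ⟨z, ⟨hz, hd⟩, rfl⟩
      exact ⟨⟨by rw [Finset.card_insert_of_notMem hz, hτ], hd⟩, Finset.subset_insert _ _⟩
  have hroomcard : ∀ τ, τ.card + 1 = Fintype.card ι →
      (R.bipartiteAbove (fun τ S => τ ⊆ S) τ).card =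
        (Finset.univ.filter fun z => z ∉ τ ∧ Dominant r (insert z τ)).card := fun τ hτ => by
    rw [hrooms τ hτ, Finset.card_image_of_injOn]
    intro z hz w hw hzw
    have hz' := (Finset.mem_filter.1 hz).2.1
    have hmem : z ∈ insert w τ := (congrArg (z ∈ ·) hzw).mp (Finset.mem_insert_self z τ)
    exact (Finset.mem_insert.1 hmem).resolve_right hz'
  -- The door `τ₀` opens into one room and every other door into two, so the count is odd.
  set τ₀ := (Finset.univ.erase o).image e with hτ₀
  have hτ₀card : τ₀.card + 1 = Fintype.card ι := by
    rw [hτ₀, Finset.card_image_of_injective _ he, Finset.card_erase_add_one (Finset.mem_univ _),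
      Finset.card_univ]
  obtain ⟨x₀, hx₀⟩ := exists_unique_dominant_extension_corners hr hmin hbig he o
  have hτ₀D : τ₀ ∈ D := (hD _).2 ⟨⟨hτ₀card, by
    rw [hτ₀, Finset.image_image]
    simp [Function.comp_def, hce]⟩,
    hdom_sub (Finset.subset_insert _ _) ((hx₀ x₀).2 rfl).2⟩
  rw [← Finset.add_sum_erase _ _ hτ₀D, hroomcard _ hτ₀card] at hcount
  have hone : (Finset.univ.filter fun z => z ∉ τ₀ ∧ Dominant r (insert z τ₀)).card = 1 := by
    rw [Finset.card_eq_one]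
    refine ⟨x₀, ?_⟩
    ext z
    simpa only [Finset.mem_filter, Finset.mem_univ, true_and, Finset.mem_singleton] using hx₀ z
  have hrest : Even (∑ τ ∈ D.erase τ₀, (R.bipartiteAbove (fun τ S => τ ⊆ S) τ).card) := by
    refine Finset.even_sum _ fun τ hτ => ?_
    obtain ⟨hne, hτD⟩ := Finset.mem_erase.1 hτ
    obtain ⟨⟨hτc, hτi⟩, hτd⟩ := (hD τ).1 hτD
    -- The set of corners `τ₀` is the only door consisting of corners.
    have hin : ∃ t ∈ τ, t ∉ Set.range e := by
      by_contra! hall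
      refine hne (Finset.eq_of_subset_of_card_le (fun t ht => ?_) (by omega))
      obtain ⟨j, rfl⟩ := hall t ht
      refine Finset.mem_image_of_mem e ?_
      rw [← hτi, ← hce j]
      simpa only [hce] using Finset.mem_image_of_mem c ht
    obtain ⟨x, y, hxy, hz⟩ := exists_two_dominant_extensions hr hmin hbig hτd hτc hin
    rw [hroomcard _ hτc, show (Finset.univ.filter fun z => z ∉ τ ∧ Dominant r (insert z τ)) =
      {x, y} by ext z; simp only [Finset.mem_filter, Finset.mem_univ, true_and, hz,
        Finset.mem_insert, Finset.mem_singleton], Finset.card_pair hxy]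
    exact even_two
  rw [hone] at hcount
  exact Nat.not_even_iff_odd.2 (odd_one.add_even hrest) (hcount ▸ hright)

end Parity

/-! ### From grid colourings to closed covers of the simplex -/

/-- Ranking of grid points (`Sum.inl`) and corners (`Sum.inr`) in direction `i`: the `i`-th
coordinate for grid points of sum `N`, with the `i`-th corner below and the others above them. -/
def cornerRank {ι κ : Type*} [DecidableEq ι] (x : κ → ι → ℕ) (N : ℕ) (i : ι) : κ ⊕ ι → ℕ
  | Sum.inl p => x p i + 1
  | Sum.inr j => if j = i then 0 else N + 2

/-- Colour the lattice points of the `N`-th dilate of the simplex arbitrarily. Then some lattice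
point has, for each colour `i`, either a small `i`-th coordinate or a point of colour `i`
nearby. -/
theorem exists_near_all_colours {ι : Type*} [Fintype ι] [DecidableEq ι] [Nonempty ι] (N : ℕ)
    (c : Finset.piAntidiag (Finset.univ : Finset ι) N → ι) :
    ∃ p : Finset.piAntidiag (Finset.univ : Finset ι) N, ∀ i,
      p.1 i ≤ Fintype.card ι ∨ ∃ q, c q = i ∧
        ∀ k, p.1 k ≤ q.1 k + Fintype.card ι ∧ q.1 k ≤ p.1 k + Fintype.card ι := by
  classical
  let T : Finset (ι → ℕ) := Finset.univ.piAntidiag N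
  have hTmem : ∀ f : ι → ℕ, f ∈ T ↔ ∑ i, f i = N := fun f => by simp [T]
  let h : ι → T ⊕ ι → ℕ := cornerRank (fun p => p.1) N
  have hle : ∀ (p : T) i, p.1 i ≤ N := fun p i =>
    ((hTmem _).1 p.2) ▸ Finset.single_le_sum (fun _ _ => Nat.zero_le _) (Finset.mem_univ i)
  -- Ties between equal coordinates are broken by an arbitrary enumeration.
  let enc := Fintype.equivFin (T ⊕ ι)
  let r : ι → T ⊕ ι → ℕ ×ₗ Fin (Fintype.card (T ⊕ ι)) := fun i a => toLex (h i a, enc a)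
  have hrlt : ∀ i a b, h i a < h i b → r i a < r i b := fun i a b hab =>
    (Prod.Lex.toLex_lt_toLex).2 (Or.inl hab)
  have hrle : ∀ i a b, r i a ≤ r i b → h i a ≤ h i b := fun i a b hab => by
    by_contra hlt
    exact absurd hab (not_le.2 (hrlt i b a (not_le.1 hlt)))
  obtain ⟨S, hSd, hSc⟩ := exists_dominant_image_eq_univ (r := r) (e := Sum.inr)
    (fun i a b hab => enc.injective (congrArg (fun z => (ofLex z).2) hab))
    (fun i y => by
      rcases y with p | j
      · exact (hrlt i _ _ (by simp [h, cornerRank])).le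
      · by_cases hj : j = i
        · rw [hj]
        · exact (hrlt i _ _ (by simp [h, cornerRank, hj])).le)
    (fun i j x hij hx => by
      rcases x with p | k
      · exact hrlt i _ _ (by simp only [h, cornerRank, if_neg hij.symm]; have := hle p i; omega)
      · exact absurd ⟨k, rfl⟩ hx)
    (Sum.elim c id) (fun i => rfl)
  have hcol : ∀ i, Sum.inr i ∉ S → ∃ q : T, Sum.inl q ∈ S ∧ c q = i := fun i hi => by
    obtain ⟨a, ha, hai⟩ := Finset.mem_image.1 (hSc ▸ Finset.mem_univ i)
    rcases a with q | j
    · exact ⟨q, ha, hai⟩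
    · exact absurd ((show j = i from hai) ▸ ha) hi
  -- A direction witnessing dominance against a grid point cannot have its corner in `S`.
  have hdom : ∀ y : T, ∃ i, Sum.inr i ∉ S ∧ ∀ q : T, Sum.inl q ∈ S → y.1 i ≤ q.1 i := fun y => by
    obtain ⟨i, hi⟩ := hSd (Sum.inl y)
    refine ⟨i, fun hiS => ?_, fun q hq => ?_⟩
    · have := hrle i _ _ (hi _ hiS)
      simp [h, cornerRank] at this
    · have := hrle i _ _ (hi _ hq)
      simpa [h, cornerRank] using this
  let P : Finset T := Finset.univ.filter fun q => Sum.inl q ∈ S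
  have hP : ∀ q, q ∈ P ↔ Sum.inl q ∈ S := fun q => by simp [P]
  have hPne : P.Nonempty := by
    obtain ⟨i₀⟩ := ‹Nonempty ι›
    obtain ⟨i, hi, -⟩ := hdom ⟨Pi.single i₀ N, (hTmem _).2 (by simp)⟩
    obtain ⟨q, hq, -⟩ := hcol i hi
    exact ⟨q, (hP q).2 hq⟩
  let C : Finset ι := Finset.univ.filter fun i => Sum.inr i ∉ S
  have hC : ∀ i, i ∈ C ↔ Sum.inr i ∉ S := fun i => by simp [C]
  -- `M` collects the coordinatewise minima of the grid points of `S`, over the directions in `C`.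
  let M : ι → ℕ := fun i => if i ∈ C then P.inf' hPne (fun q => q.1 i) else 0
  have hMle : ∀ q ∈ P, ∀ i, M i ≤ q.1 i := fun q hq i => by
    by_cases hi : i ∈ C
    · simp only [M, if_pos hi]
      exact Finset.inf'_le _ hq
    · simp [M, hi]
  -- Otherwise some grid point would exceed all these minima.
  have hsum : N < ∑ i, (M i + 1) := by
    by_contra! hcon
    obtain ⟨i₀⟩ := ‹Nonempty ι›
    obtain ⟨i, hi, hiq⟩ := hdom ⟨(fun i => M i + 1) + Pi.single i₀ (N - ∑ i, (M i + 1)),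
      (hTmem _).2 (by
        simp only [Pi.add_apply, Finset.sum_add_distrib (g := Pi.single i₀ _),
          Finset.sum_pi_single',
          Finset.mem_univ, if_true]
        omega)⟩
    obtain ⟨q, hq, hqi⟩ := P.exists_mem_eq_inf' hPne (fun q => q.1 i)
    have h1 := hiq q ((hP q).1 hq)
    have h2 : M i = q.1 i := by simp only [M, if_pos ((hC i).2 hi), hqi]
    simp only [Pi.add_apply] at h1
    omega
  have hupper : ∀ q ∈ P, ∀ i, q.1 i ≤ M i + Fintype.card ι := fun q hq i => by
    have h1 := (hTmem _).1 q.2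
    rw [Finset.sum_add_distrib, Finset.sum_const, Finset.card_univ, smul_eq_mul, mul_one] at hsum
    have h2 := Finset.sum_le_sum fun k (_ : k ∈ Finset.univ.erase i) => hMle q hq k
    rw [← Finset.add_sum_erase _ _ (Finset.mem_univ i)] at h1 hsum
    omega
  obtain ⟨p, hp⟩ := hPne
  refine ⟨p, fun i => ?_⟩
  by_cases hi : i ∈ C
  · obtain ⟨q, hq, hqi⟩ := hcol i ((hC i).1 hi)
    refine Or.inr ⟨q, hqi, fun k => ?_⟩
    have h1 := hMle p hp k
    have h2 := hMle q ((hP q).2 hq) k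
    have h3 := hupper p hp k
    have h4 := hupper q ((hP q).2 hq) k
    omega
  · refine Or.inl ?_
    have := hupper p hp i
    simpa [M, hi] using this

/-- A nested family of closed conditions, indexed by `ε > 0`, that are all satisfiable in a compact
set has a common solution there. -/
theorem IsCompact.exists_forall_pos_mem {X : Type*} [TopologicalSpace X] [T2Space X] {s : Set X}
    (hs : IsCompact s) {K : ℝ → Set X} (hK : ∀ ε, IsClosed (K ε)) (hmono : Monotone K)
    (hne : ∀ ε > 0, (s ∩ K ε).Nonempty) : ∃ x ∈ s, ∀ ε > 0, x ∈ K ε := by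
  have : Nonempty (Set.Ioi (0 : ℝ)) := ⟨⟨1, Set.mem_Ioi.2 one_pos⟩⟩
  obtain ⟨x, hx⟩ := IsCompact.nonempty_iInter_of_directed_nonempty_isCompact_isClosed
    (fun ε : Set.Ioi (0 : ℝ) => s ∩ K ε)
    (fun a b => ⟨min a b, Set.inter_subset_inter_right _ (hmono (min_le_left (a : ℝ) b)),
      Set.inter_subset_inter_right _ (hmono (min_le_right (a : ℝ) b))⟩)
    (fun ε => hne ε ε.2) (fun ε => hs.inter_right (hK ε)) (fun ε => hs.isClosed.inter (hK ε))
  rw [Set.mem_iInter] at hx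
  exact ⟨x, (hx ⟨1, Set.mem_Ioi.2 one_pos⟩).1, fun ε hε => (hx ⟨ε, hε⟩).2⟩

/-- For a closed set `A`, being in all sufficiently small thickenings of `A` means being in `A`. -/
theorem IsClosed.eventually_mem_of_mem_cthickening {X : Type*} [PseudoEMetricSpace X] {A : Set X}
    (hA : IsClosed A) (x : X) : ∀ᶠ ε in nhdsWithin (0 : ℝ) (Set.Ioi 0),
      x ∈ Metric.cthickening ε A → x ∈ A := by
  by_cases hx : x ∈ A
  · exact Filter.Eventually.of_forall fun _ _ => hx
  · have hx' : x ∉ ⋂ (δ : ℝ) (_ : 0 < δ), Metric.cthickening δ A := by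
      rwa [← Metric.closure_eq_iInter_cthickening, hA.closure_eq]
    simp only [Set.mem_iInter, not_forall] at hx'
    obtain ⟨δ, hδ, hxδ⟩ := hx'
    filter_upwards [Ioo_mem_nhdsGT hδ] with ε hε h
    exact absurd (Metric.cthickening_mono hε.2.le A h) hxδ

/-- **Dual KKM theorem**: for closed sets `A i` covering the simplex, some point `x` of the simplex
lies in `A i` whenever `x i ≠ 0`. -/
theorem exists_mem_of_ne_zero {ι : Type*} [Fintype ι] [Nonempty ι] (A : ι → Set (ι → ℝ))
    (hA : ∀ i, IsClosed (A i)) (hcov : ∀ x ∈ stdSimplex ℝ ι, ∃ i, x ∈ A i) :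
    ∃ x ∈ stdSimplex ℝ ι, ∀ i, x i ≠ 0 → x ∈ A i := by
  classical
  let K : ℝ → Set (ι → ℝ) := fun ε => ⋂ i, {x | x i ≤ ε} ∪ Metric.cthickening ε (A i)
  have hK : ∀ ε x, x ∈ K ε ↔ ∀ i, x i ≤ ε ∨ x ∈ Metric.cthickening ε (A i) := fun ε x => by
    simp [K]
  obtain ⟨x, hx, hxK⟩ := (isCompact_stdSimplex ℝ ι).exists_forall_pos_mem (K := K)
    (fun ε => isClosed_iInter fun i =>
      (isClosed_le (continuous_apply i) continuous_const).union Metric.isClosed_cthickening)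
    (fun ε δ h x hx => (hK _ _).2 fun i => ((hK _ _).1 hx i).imp (fun h' => h'.trans h)
      fun h' => Metric.cthickening_mono h _ h')
    (fun ε hε => by
      obtain ⟨N, hN⟩ := exists_nat_gt ((Fintype.card ι : ℝ) / ε)
      have hN0 : (0 : ℝ) < N := lt_of_le_of_lt (by positivity) hN
      have hNε : (Fintype.card ι : ℝ) ≤ ε * N := by
        rw [div_lt_iff₀ hε] at hN
        linarith
      let u : Finset.piAntidiag (Finset.univ : Finset ι) N → ι → ℝ := fun p i => p.1 i / N
      have hu : ∀ p, u p ∈ stdSimplex ℝ ι := fun p => by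
        refine ⟨fun i => by positivity, ?_⟩
        have hp : ∑ i, p.1 i = N := (Finset.mem_piAntidiag.1 p.2).1
        rw [← Finset.sum_div, ← Nat.cast_sum, hp, div_self hN0.ne']
      choose c hc using fun p => hcov (u p) (hu p)
      obtain ⟨p, hp⟩ := exists_near_all_colours N c
      refine ⟨u p, hu p, (hK _ _).2 fun i => (hp i).imp (fun h => ?_) ?_⟩
      · have h' : (p.1 i : ℝ) ≤ Fintype.card ι := by exact_mod_cast h
        exact (div_le_iff₀ hN0).2 (h'.trans hNε)
      · rintro ⟨q, rfl, hq⟩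
        refine Metric.mem_cthickening_of_dist_le _ (u q) _ _ (hc q) ?_
        refine (dist_pi_le_iff hε.le).2 fun k => ?_
        have h1 : (p.1 k : ℝ) ≤ q.1 k + Fintype.card ι := by exact_mod_cast (hq k).1
        have h2 : (q.1 k : ℝ) ≤ p.1 k + Fintype.card ι := by exact_mod_cast (hq k).2
        rw [Real.dist_eq, ← sub_div, abs_div, abs_of_pos hN0, div_le_iff₀ hN0, abs_le]
        constructor <;> linarith)
  refine ⟨x, hx, fun i hi => ?_⟩
  have hpos : 0 < x i := lt_of_le_of_ne (hx.1 i) (Ne.symm hi)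
  obtain ⟨ε, ⟨hε, hxi⟩, hmem⟩ := ((Filter.Eventually.and (Ioo_mem_nhdsGT hpos)
    ((hA i).eventually_mem_of_mem_cthickening x))).exists
  exact hmem (((hK ε x).1 (hxK ε hε) i).resolve_left (not_le.2 hxi))

/-! ### Hall's condition for balanced weights -/

/-- A nonnegative `d × (d + 1)` matrix with row sums `1` and column sums at most `d / (d + 1)`
still has a perfect matching in its support after deleting any column. -/
theorem exists_equiv_of_balanced {d : ℕ} (w : Fin d → Fin (d + 1) → ℝ) (hw : ∀ j k, 0 ≤ w j k)
    (hrow : ∀ j, ∑ k, w j k = 1) (hcol : ∀ k, ∑ j, w j k ≤ (d : ℝ) / (d + 1)) (i : Fin (d + 1)) :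
    ∃ π : Fin d ≃ {k : Fin (d + 1) // k ≠ i}, ∀ j, 0 < w j (π j) := by
  classical
  obtain ⟨f, hf, hpos⟩ := (Fintype.all_card_le_filter_rel_iff_exists_injective
    (fun (j : Fin d) (k : {k : Fin (d + 1) // k ≠ i}) => 0 < w j k)).1 fun A => by
    set B : Finset {k : Fin (d + 1) // k ≠ i} := {b | ∃ a ∈ A, 0 < w a b} with hB
    -- The whole weight of the rows in `A` sits in column `i` and the columns in `B`.
    have h1 : (A.card : ℝ) ≤ (d : ℝ) / (d + 1) * (1 + B.card) := by
      calc (A.card : ℝ) = ∑ a ∈ A, ∑ k, w a k := by simp [hrow]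
        _ = ∑ a ∈ A, (w a i + ∑ b ∈ B, w a b) := by
          refine Finset.sum_congr rfl fun a ha => ?_
          rw [Fintype.sum_eq_add_sum_subtype_ne _ i, add_right_inj]
          refine (Finset.sum_subset (Finset.subset_univ B) fun b _ hb => ?_).symm
          by_contra hne
          exact hb (Finset.mem_filter.2
            ⟨Finset.mem_univ _, a, ha, lt_of_le_of_ne (hw a b) (Ne.symm hne)⟩)
        _ ≤ ∑ a, (w a i + ∑ b ∈ B, w a b) :=
          Finset.sum_le_sum_of_subset_of_nonneg (Finset.subset_univ A) fun a _ _ =>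
            add_nonneg (hw a i) (Finset.sum_nonneg fun b _ => hw a b)
        _ = ∑ a, w a i + ∑ b ∈ B, ∑ a, w a b := by
          rw [Finset.sum_add_distrib, Finset.sum_comm]
        _ ≤ (d : ℝ) / (d + 1) + ∑ _b ∈ B, (d : ℝ) / (d + 1) :=
          add_le_add (hcol i) (Finset.sum_le_sum fun b _ => hcol b)
        _ = (d : ℝ) / (d + 1) * (1 + B.card) := by
          rw [Finset.sum_const, nsmul_eq_mul]
          ring
    by_contra! hlt
    have h2 : (1 : ℝ) + B.card ≤ A.card := by
      rw [add_comm]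
      exact_mod_cast hlt
    have hA : (0 : ℝ) < A.card := by exact_mod_cast Nat.zero_lt_of_lt hlt
    have h3 : (d : ℝ) / (d + 1) < 1 := by
      rw [div_lt_one (by positivity)]
      linarith
    have h4 : (d : ℝ) / (d + 1) * (1 + B.card) ≤ (d : ℝ) / (d + 1) * A.card := by gcongr
    nlinarith
  have hcard : Fintype.card (Fin d) = Fintype.card {k : Fin (d + 1) // k ≠ i} := by
    simp [Fintype.card_subtype_compl]
  exact ⟨Equiv.ofBijective f ((Fintype.bijective_iff_injective_and_card f).2 ⟨hf, hcard⟩), hpos⟩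

/-! ### Balanced weights subordinate to the covers -/

/-- The facet opposite to vertex `i` lies in the `i`-th set of a dual KKM cover. -/
theorem IsDualKKMCover.mem_of_eq_zero {d : ℕ} {C : Fin (d + 1) → Set (Fin (d + 1) → ℝ)}
    (hC : IsDualKKMCover C) {x : Fin (d + 1) → ℝ} (hx : x ∈ stdSimplex ℝ (Fin (d + 1)))
    {i : Fin (d + 1)} (hi : x i = 0) : x ∈ C i := by
  have := hC.face_subset {i}ᶜ (by simp)
    ⟨hx, fun k hk => by
      have hki : k = i := by simpa using hk
      rw [hki, hi]⟩
  simpa using this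

/-- The points of the simplex at which the `i`-th coordinate is small are close to the facet
opposite to vertex `i`. -/
theorem exists_eq_zero_dist_le {d : ℕ} (hd : 0 < d) {x : Fin (d + 1) → ℝ}
    (hx : x ∈ stdSimplex ℝ (Fin (d + 1))) (i : Fin (d + 1)) :
    ∃ y ∈ stdSimplex ℝ (Fin (d + 1)), y i = 0 ∧ dist x y ≤ x i := by
  have : Nontrivial (Fin (d + 1)) := Fin.nontrivial_iff_two_le.2 (by omega)
  obtain ⟨k, hk⟩ := exists_ne i
  -- Move the mass at `i` to `k`.
  have hxi := hx.1 i
  refine ⟨x - Pi.single i (x i) + Pi.single k (x i), ⟨fun j => ?_, ?_⟩, ?_, ?_⟩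
  · have hj := hx.1 j
    by_cases hji : j = i
    · subst hji
      simp [hk.symm]
    · by_cases hjk : j = k
      · subst hjk
        simp only [Pi.add_apply, Pi.sub_apply, Pi.single_eq_of_ne hji, Pi.single_eq_same]
        linarith
      · simpa [hji, hjk] using hj
  · have h := hx.2
    simp only [Pi.add_apply, Pi.sub_apply, Finset.sum_add_distrib, Finset.sum_sub_distrib, h,
      Finset.sum_pi_single', Finset.mem_univ, if_true]
    simp
  · simp [hk.symm]
  · refine (dist_pi_le_iff hxi).2 fun j => ?_
    rw [Real.dist_eq, abs_le]
    simp only [Pi.add_apply, Pi.sub_apply, Pi.single_apply]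
    split_ifs <;> constructor <;> linarith

/-- Unnormalised weight of a point with respect to a set `A`: positive in the interior of the
simplex if `A` is within distance less than `ε` or the `i`-th coordinate is less than `ε`, on the
boundary only in the latter case. -/
noncomputable def coverWeight {ι : Type*} [Fintype ι] (ε : ℝ) (A : Set (ι → ℝ)) (i : ι)
    (x : ι → ℝ) : ℝ :=
  max 0 (ε - Metric.infDist x A) * ∏ k, x k + max 0 (ε - x i)

theorem continuous_coverWeight {ι : Type*} [Fintype ι] (ε : ℝ) (A : Set (ι → ℝ)) (i : ι) :
    Continuous (coverWeight ε A i) := by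
  unfold coverWeight
  have := Metric.continuous_infDist_pt A
  fun_prop

theorem coverWeight_nonneg {ι : Type*} [Fintype ι] (ε : ℝ) (A : Set (ι → ℝ)) (i : ι)
    {x : ι → ℝ} (hx : x ∈ stdSimplex ℝ ι) : 0 ≤ coverWeight ε A i x :=
  add_nonneg (mul_nonneg (le_max_left _ _) (Finset.prod_nonneg fun k _ => hx.1 k))
    (le_max_left _ _)

/-- Some weight is positive at each point: in the interior because the sets cover, on the boundary
because a coordinate vanishes. -/
theorem IsDualKKMCover.sum_coverWeight_pos {d : ℕ} {C : Fin (d + 1) → Set (Fin (d + 1) → ℝ)}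
    (hC : IsDualKKMCover C) {ε : ℝ} (hε : 0 < ε) {x : Fin (d + 1) → ℝ}
    (hx : x ∈ stdSimplex ℝ (Fin (d + 1))) : 0 < ∑ i, coverWeight ε (C i) i x := by
  suffices ∃ i, 0 < coverWeight ε (C i) i x by
    obtain ⟨i, hi⟩ := this
    exact Finset.sum_pos' (fun k _ => coverWeight_nonneg ε _ k hx) ⟨i, Finset.mem_univ _, hi⟩
  by_cases hzero : ∃ i, x i = 0
  · obtain ⟨i, hi⟩ := hzero
    exact ⟨i, add_pos_of_nonneg_of_pos
      (mul_nonneg (le_max_left _ _) (Finset.prod_nonneg fun k _ => hx.1 k)) (by simp [hi, hε])⟩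
  · push Not at hzero
    obtain ⟨i, hi⟩ := Set.mem_iUnion.1 (hC.iUnion_eq ▸ hx)
    refine ⟨i, add_pos_of_pos_of_nonneg (mul_pos ?_ (Finset.prod_pos fun k _ =>
      lt_of_le_of_ne (hx.1 k) (hzero k).symm)) (le_max_left _ _)⟩
    simp [Metric.infDist_zero_of_mem hi, hε]

theorem IsDualKKMCover.mem_cthickening_of_coverWeight_pos {d : ℕ} (hd : 0 < d)
    {C : Fin (d + 1) → Set (Fin (d + 1) → ℝ)} (hC : IsDualKKMCover C) {ε : ℝ}
    {x : Fin (d + 1) → ℝ} (hx : x ∈ stdSimplex ℝ (Fin (d + 1))) {i : Fin (d + 1)}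
    (h : 0 < coverWeight ε (C i) i x) : x ∈ Metric.cthickening ε (C i) := by
  obtain ⟨y, hy, hyi, hxy⟩ := exists_eq_zero_dist_le hd hx i
  have hyC := hC.mem_of_eq_zero hy hyi
  by_cases hxi : x i ≤ ε
  · exact Metric.mem_cthickening_of_dist_le x y ε _ hyC (hxy.trans hxi)
  · have hinf : Metric.infDist x (C i) < ε := by
      by_contra! hle
      simp [coverWeight, max_eq_left (sub_nonpos.2 hle),
        max_eq_left (sub_nonpos.2 (not_le.1 hxi).le)] at h
    obtain ⟨z, hz, hxz⟩ := (Metric.infDist_lt_iff ⟨y, hyC⟩).1 hinf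
    exact Metric.mem_cthickening_of_dist_le x z ε _ hz hxz.le

/-- If `ε` is small, the normalised weights of `d` dual KKM covers are balanced at some point: each
column sum is at least the average `d / (d + 1)`. -/
theorem exists_balanced_coverWeight {d : ℕ} (hd : 0 < d)
    (C : Fin d → Fin (d + 1) → Set (Fin (d + 1) → ℝ)) (hC : ∀ j, IsDualKKMCover (C j)) {ε : ℝ}
    (hε : 0 < ε) (hε' : ε * (d + 1) < 1) :
    ∃ x ∈ stdSimplex ℝ (Fin (d + 1)), ∀ i, (d : ℝ) / (d + 1) ≤
      ∑ j, coverWeight ε (C j i) i x / ∑ k, coverWeight ε (C j k) k x := by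
  let Δ := stdSimplex ℝ (Fin (d + 1))
  let F : Fin (d + 1) → (Fin (d + 1) → ℝ) → ℝ := fun i x =>
    ∑ j, coverWeight ε (C j i) i x / ∑ k, coverWeight ε (C j k) k x
  have hpos : ∀ j, ∀ x ∈ Δ, 0 < ∑ k, coverWeight ε (C j k) k x := fun j x hx =>
    (hC j).sum_coverWeight_pos hε hx
  have hF : ∀ i, ContinuousOn (F i) Δ := fun i => continuousOn_finsetSum _ fun j _ =>
    (continuous_coverWeight ε _ i).continuousOn.div
      (continuous_finsetSum _ fun k _ => continuous_coverWeight ε _ k).continuousOn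
      fun x hx => (hpos j x hx).ne'
  have hsum : ∀ x ∈ Δ, ∑ i, F i x = ∑ _i : Fin (d + 1), (d : ℝ) / (d + 1) := fun x hx => by
    simp only [F]
    rw [Finset.sum_comm]
    simp only [← Finset.sum_div, div_self (hpos _ x hx).ne']
    simp only [Finset.sum_const, Finset.card_univ, Fintype.card_fin, nsmul_eq_mul]
    push_cast
    field_simp
  obtain ⟨x, hx, hxA⟩ := exists_mem_of_ne_zero
    (fun i => Δ ∩ F i ⁻¹' Set.Ici ((d : ℝ) / (d + 1)))
    (fun i => (hF i).preimage_isClosed_of_isClosed (isClosed_stdSimplex ℝ _) isClosed_Ici)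
    (fun x hx => by
      obtain ⟨i, -, hi⟩ := Finset.exists_le_of_sum_le Finset.univ_nonempty (hsum x hx).ge
      exact ⟨i, hx, hi⟩)
  refine ⟨x, hx, fun i => (hxA i fun hi => ?_).2⟩
  -- On the boundary, the largest coordinate of `x` is at least `ε` and so carries no weight.
  obtain ⟨k, -, hk⟩ := Finset.exists_le_of_sum_le (s := Finset.univ)
    (f := fun _ : Fin (d + 1) => ε) (g := x) Finset.univ_nonempty (by
      rw [hx.2]
      simp only [Finset.sum_const, Finset.card_univ, Fintype.card_fin, nsmul_eq_mul]
      push_cast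
      linarith)
  have hFk : F k x = 0 := Finset.sum_eq_zero fun j _ => by
    rw [show coverWeight ε (C j k) k x = 0 by
      simp only [coverWeight, Finset.prod_eq_zero (Finset.mem_univ i) hi, mul_zero, zero_add]
      exact max_eq_left (sub_nonpos.2 hk), zero_div]
  have hle : (d : ℝ) / (d + 1) ≤ F k x := (hxA k (hε.trans_le hk).ne').2
  rw [hFk] at hle
  have : (0 : ℝ) < (d : ℝ) / (d + 1) := by positivity
  linarith

/-- The approximate form of the theorem, with each set replaced by a thickening. -/
theorem exists_matchings_cthickening {d : ℕ} (hd : 0 < d)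
    (C : Fin d → Fin (d + 1) → Set (Fin (d + 1) → ℝ)) (hC : ∀ j, IsDualKKMCover (C j)) {ε : ℝ}
    (hε : 0 < ε) (hε' : ε * (d + 1) < 1) :
    ∃ x ∈ stdSimplex ℝ (Fin (d + 1)),
      ∃ π : (i : Fin (d + 1)) → (Fin d ≃ {k : Fin (d + 1) // k ≠ i}),
        ∀ i j, x ∈ Metric.cthickening ε (C j (π i j)) := by
  obtain ⟨x, hx, hbal⟩ := exists_balanced_coverWeight hd C hC hε hε'
  have hpos : ∀ j, 0 < ∑ k, coverWeight ε (C j k) k x := fun j =>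
    (hC j).sum_coverWeight_pos hε hx
  let w : Fin d → Fin (d + 1) → ℝ := fun j k =>
    coverWeight ε (C j k) k x / ∑ l, coverWeight ε (C j l) l x
  have hrow : ∀ j, ∑ k, w j k = 1 := fun j => by
    simp only [w, ← Finset.sum_div, div_self (hpos j).ne']
  -- The column sums add up to `d`, so none of them exceeds the average.
  have hcol : ∀ k, ∑ j, w j k = (d : ℝ) / (d + 1) := by
    have htot : ∑ _k : Fin (d + 1), (d : ℝ) / (d + 1) = ∑ k, ∑ j, w j k := by
      rw [Finset.sum_comm]
      simp only [hrow, Finset.sum_const, Finset.card_univ, Fintype.card_fin, nsmul_eq_mul]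
      push_cast
      field_simp
    exact fun k => ((Finset.sum_eq_sum_iff_of_le fun k _ => hbal k).1 htot k
      (Finset.mem_univ k)).symm
  choose π hπ using exists_equiv_of_balanced w
    (fun j k => div_nonneg (coverWeight_nonneg ε _ k hx) (hpos j).le) hrow fun k => (hcol k).le
  exact ⟨x, hx, π, fun i j => (hC j).mem_cthickening_of_coverWeight_pos hd hx
    ((div_pos_iff_of_pos_right (hpos j)).1 (hπ i j))⟩

/-! ### Passage to the limit -/

theorem mainTheorem6 (d : ℕ) (C : Fin d → Fin (d + 1) → Set (Fin (d + 1) → ℝ))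
    (hC : ∀ j, IsDualKKMCover (C j)) :
    ∃ x ∈ stdSimplex ℝ (Fin (d + 1)),
      ∃ π : (i : Fin (d + 1)) → (Fin d ≃ {k : Fin (d + 1) // k ≠ i}),
        ∀ i j, x ∈ C j (π i j) := by
  rcases Nat.eq_zero_or_pos d with rfl | hd
  · have : ∀ i : Fin 1, IsEmpty {k : Fin 1 // k ≠ i} := fun i =>
      ⟨fun k => k.2 (Subsingleton.elim _ _)⟩
    exact ⟨_, single_mem_stdSimplex ℝ 0, fun i => Equiv.equivOfIsEmpty _ _, fun i j => j.elim0⟩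
  let K : ℝ → Set (Fin (d + 1) → ℝ) := fun ε =>
    ⋃ π : (i : Fin (d + 1)) → (Fin d ≃ {k : Fin (d + 1) // k ≠ i}),
      ⋂ i, ⋂ j, Metric.cthickening ε (C j (π i j))
  have hK : ∀ ε x, x ∈ K ε ↔ ∃ π : (i : Fin (d + 1)) → (Fin d ≃ {k : Fin (d + 1) // k ≠ i}),
      ∀ i j, x ∈ Metric.cthickening ε (C j (π i j)) := fun ε x => by simp [K]
  have hmono : Monotone K := fun ε δ h x hx => by
    obtain ⟨π, hπ⟩ := (hK _ _).1 hx
    exact (hK _ _).2 ⟨π, fun i j => Metric.cthickening_mono h _ (hπ i j)⟩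
  obtain ⟨x, hx, hxK⟩ := (isCompact_stdSimplex ℝ (Fin (d + 1))).exists_forall_pos_mem (K := K)
    (fun ε => isClosed_iUnion_of_finite fun π => isClosed_iInter fun i => isClosed_iInter fun j =>
      Metric.isClosed_cthickening) hmono
    (fun ε hε => by
      have hd1 : (0 : ℝ) < 1 / (d + 2) := by positivity
      obtain ⟨x, hx, hπ⟩ := exists_matchings_cthickening hd C hC (lt_min hε hd1) (by
        refine lt_of_le_of_lt (mul_le_mul_of_nonneg_right (min_le_right _ _) (by positivity)) ?_
        rw [div_mul_eq_mul_div, one_mul, div_lt_one (by positivity)]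
        linarith)
      exact ⟨x, hx, hmono (min_le_left _ _) ((hK _ _).2 hπ)⟩)
  -- For one small `ε`, lying in the `ε`-thickening of any of the finitely many sets means lying
  -- in the set itself.
  have hev : ∀ᶠ ε in nhdsWithin (0 : ℝ) (Set.Ioi 0),
      ∀ j k, x ∈ Metric.cthickening ε (C j k) → x ∈ C j k :=
    Filter.eventually_all.2 fun j => Filter.eventually_all.2 fun k =>
      ((hC j).isClosed k).eventually_mem_of_mem_cthickening x
  obtain ⟨ε, hmem, hε⟩ := (hev.and self_mem_nhdsWithin).exists
  obtain ⟨π, hπ⟩ := (hK ε x).1 (hxK ε hε)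
  exact ⟨x, hx, π, fun i j => hmem _ _ (hπ i j)⟩
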